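/- Let $M$ be a compact topological manifold (without boundary) of dimension $\ge 2$, with a metric $d$ inducing its topology, and let $\mathrm{Hom}(M)$ be the space of homeomorphisms of $M$ with the metric $d_{C^0}(f,g)=\max_{x\in M} d(f(x),g(x))$. For $f\in \mathrm{Hom}(M)$, a continuous strict Lyapunov function for $f$ is a continuous $u:M\to\mathbb{R}$ with $u(f(x))\le u(x)$ for all $x\in M$ and $u(f(x))<u(x)$ for some $x\in M$. The generalized recurrent set $\mathcal{GR}(f)$ is the set of $x\in M$ such that, for every metric $\delta$ on $M$ compatible with the topology and every $\varepsilon>0$, there are $n\ge 1$ and points $x_1=x,x_2,\dots,x_n,x_{n+1}=x$ with $\sum_{i=1}^n \delta(f(x_i),x_{i+1})<\varepsilon$. A decomposition of $\mathcal{GR}(f)$ is a finite family $L_1,\dots,L_k$ of pairwise disjoint compact sets with $f(L_i)=L_i$ and $\mathcal{GR}(f)=\bigcup_{i=1}^k L_i$. For a compact invariant set $L$ put $W^s(L)=\{x: d(f^m(x),L)\to 0 \text{ as } m\to+\infty\}$ and $W^u(L)=\{x: d(f^{-m}(x),L)\to 0 \text{ as } m\to+\infty\}$. Write $L_i\rightharpoonup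 L_j$ if $(W^u(L_i)\cap W^s(L_j))\setminus\mathcal{GR}(f)\neq\emptyset$. The decomposition is without cycles if there are no $r\ge 1$ and distinct indices $i_1,\dots,i_r$ with $L_{i_1}\rightharpoonup L_{i_2}\rightharpoonup\cdots\rightharpoonup L_{i_r}\rightharpoonup L_{i_1}$ (for $r=1$: $L_{i_1}\rightharpoonup L_{i_1}$). **Proposition.** Let $f\in \mathrm{Hom}(M)$ admit a continuous strict Lyapunov function. If there exists a decomposition of $\mathcal{GR}(f)$ without cycles, then there exists a neighborhood $V$ of $f$ in $\mathrm{Hom}(M)$ such that every $g\in V$ admits a continuous strict Lyapunov function. -/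

import Mathlib

open Set Filter Topology

namespace GenRec

/-- The metric `d(f,g) = max_x d(f x, g x)` on the homeomorphisms of a compact metric space,
obtained from the sup metric on `C(X, X)`; see `dist_homeo_eq_iSup`. -/
noncomputable instance homeoMetricSpace {X : Type*} [MetricSpace X] [CompactSpace X] :
    MetricSpace (X ≃ₜ X) :=
  MetricSpace.induced (fun f => (⟨f, f.continuous⟩ : C(X, X)))
    (fun _ _ h => Homeomorph.ext (fun x => DFunLike.congr_fun h x)) inferInstance

theorem dist_homeo_eq_iSup {X : Type*} [MetricSpace X] [CompactSpace X] (f g : X ≃ₜ X) :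
    dist f g = ⨆ x, dist (f x) (g x) :=
  ContinuousMap.dist_eq_iSup (f := (⟨f, f.continuous⟩ : C(X, X)))
    (g := (⟨g, g.continuous⟩ : C(X, X)))

/-- There is a strong `ε`-chain from `a` to `b`: points `x 0 = a, …, x (n - 1)` with `n ≥ 1` such
that, with `x n = b`, the sum of the jumps `d(f (x i), x (i + 1))`, `i < n`, is less than `ε`.
(The values of `x` beyond `n` are irrelevant.) -/
def HasStrongChain {X : Type*} [MetricSpace X] (f : X → X) (ε : ℝ) (a b : X) : Prop :=
  ∃ (n : ℕ) (x : ℕ → X), 1 ≤ n ∧ x 0 = a ∧ x n = b ∧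
    ∑ i ∈ Finset.range n, dist (f (x i)) (x (i + 1)) < ε

/-- The strong chain recurrent set of `f` with respect to the given metric. -/
def strongChainRecurrentSet {X : Type*} [MetricSpace X] (f : X → X) : Set X :=
  {x | ∀ ε : ℝ, 0 < ε → HasStrongChain f ε x x}

/-- The generalized recurrent set: the intersection of the strong chain recurrent sets over all
metrics on `X` that induce the given topology of `X`. -/
def generalizedRecurrentSet {X : Type*} [t : TopologicalSpace X] (f : X ≃ₜ X) : Set X :=
  {x | ∀ d : MetricSpace X, d.toUniformSpace.toTopologicalSpace = t →
    x ∈ @strongChainRecurrentSet X d f}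

/-- `u` is a continuous Lyapunov function for `f`. -/
def IsContinuousLyapunov {X : Type*} [TopologicalSpace X] (f : X ≃ₜ X) (u : X → ℝ) : Prop :=
  Continuous u ∧ ∀ x, u (f x) ≤ u x

/-- `u` is a continuous strict Lyapunov function for `f`: one that is not a first integral. -/
def IsContinuousStrictLyapunov {X : Type*} [TopologicalSpace X] (f : X ≃ₜ X) (u : X → ℝ) : Prop :=
  IsContinuousLyapunov f u ∧ ∃ x, u (f x) < u x

/-- The stable set of `L`: points with `d(f^k x, L) → 0` as `k → +∞`. The distance to a set is
taken in `[0, ∞]`, so that the distance to the empty set is `∞` and its stable set is empty. -/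
def stableSet {X : Type*} [MetricSpace X] (f : X ≃ₜ X) (L : Set X) : Set X :=
  {x | Tendsto (fun k : ℕ => Metric.infEDist (f^[k] x) L) atTop (𝓝 0)}

/-- The unstable set of `L`: points with `d(f^{-k} x, L) → 0` as `k → +∞`. -/
def unstableSet {X : Type*} [MetricSpace X] (f : X ≃ₜ X) (L : Set X) : Set X :=
  {x | Tendsto (fun k : ℕ => Metric.infEDist (f.symm^[k] x) L) atTop (𝓝 0)}

/-- `L 0, …, L (k - 1)` is a decomposition of the generalized recurrent set of `f`. -/
structure IsDecomposition {X : Type*} [TopologicalSpace X] (f : X ≃ₜ X) {k : ℕ}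
    (L : Fin k → Set X) : Prop where
  isCompact : ∀ i, IsCompact (L i)
  invariant : ∀ i, f '' L i = L i
  pairwise_disjoint : ∀ i j, i ≠ j → Disjoint (L i) (L j)
  iUnion_eq : generalizedRecurrentSet f = ⋃ i, L i

/-- `A ⇀ B`: some point outside the generalized recurrent set has an orbit going from `A` to
`B`. -/
def Arrow {X : Type*} [MetricSpace X] (f : X ≃ₜ X) (A B : Set X) : Prop :=
  ((unstableSet f A ∩ stableSet f B) \ generalizedRecurrentSet f).Nonempty

/-- `L (σ 0), …, L (σ (r - 1))` form an `r`-cycle, `r ≥ 1`: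
`L (σ 0) ⇀ L (σ 1) ⇀ … ⇀ L (σ (r - 1)) ⇀ L (σ 0)` (`finRotate r` is the cyclic successor). -/
def IsCycle {X : Type*} [MetricSpace X] (f : X ≃ₜ X) {k : ℕ} (L : Fin k → Set X) (r : ℕ)
    (σ : Fin r → Fin k) : Prop :=
  1 ≤ r ∧ ∀ j : Fin r, Arrow f (L (σ j)) (L (σ (finRotate r j)))

/-- No members of the family `L` form a cycle. -/
def HasNoCycles {X : Type*} [MetricSpace X] (f : X ≃ₜ X) {k : ℕ} (L : Fin k → Set X) : Prop :=
  ∀ (r : ℕ) (σ : Fin r → Fin k), Function.Injective σ → ¬ IsCycle f L r σ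

end GenRec

/-! A point where the Lyapunov function drops is not generalized recurrent. Its backward and forward
orbits each converge to one piece, so the graph of arrows is nonempty. Being finite and without
cycles, it has an arrow ending at a sink `L c` (`HasNoCycles.exists_sink`). Without outgoing arrows,
`L c` is an attractor: it has a compact forward invariant neighborhood `C` with an iterate of `C`
inside `interior C` (`exists_trapping_neighborhood`). The orbit arriving at `L c` from outside
forces `C` to exceed `L c`, so that iterate misses some `q` in `C`. Mapping `C` into `interior C \
{q}` is a `C^0`-open condition, and it alone yields a strict Lyapunov function
(`exists_isContinuousStrictLyapunov`). -/

namespace GenRec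

/-! ### Criteria for generalized recurrence. -/

section Recurrence

/-- A continuous real function is `1`-Lipschitz for some compatible metric. -/
theorem exists_compatible_metric_sub_le {X : Type*} [d₀ : MetricSpace X] {u : X → ℝ}
    (hu : Continuous u) : ∃ d : MetricSpace X,
      d.toUniformSpace.toTopologicalSpace = d₀.toUniformSpace.toTopologicalSpace ∧
        ∀ a b, u b - u a ≤ d.dist a b := by
  -- The graph embedding: the sup metric of `X × ℝ` pulls back to a compatible metric that controls
  -- `u`.
  let e : X → X × ℝ := fun y => (y, u y)
  have he : Continuous e := continuous_id.prodMk hu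
  have hinj : Function.Injective e := fun a b hab => congrArg Prod.fst hab
  have hind : IsInducing e := IsInducing.of_comp he continuous_fst IsInducing.id
  have hdist : ∀ a b : X, u b - u a ≤ dist (e a) (e b) := fun a b =>
    calc u b - u a ≤ dist (u a) (u b) := by
          rw [dist_comm, Real.dist_eq]; exact le_abs_self _
      _ ≤ dist (e a) (e b) := le_max_right _ _
  exact ⟨MetricSpace.induced e hinj inferInstance, hind.eq_induced.symm, hdist⟩

/-- A point at which some continuous Lyapunov function decreases is not generalized recurrent. -/
theorem notMem_generalizedRecurrentSet {X : Type*} [MetricSpace X] (f : X ≃ₜ X) {u : X → ℝ}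
    (hu : IsContinuousLyapunov f u) {x : X} (hx : u (f x) < u x) :
    x ∉ generalizedRecurrentSet f := by
  intro h
  obtain ⟨d, hd, hdist⟩ := exists_compatible_metric_sub_le hu.1
  obtain ⟨n, c, hn, h0, hc, hsum⟩ := h d hd (u x - u (f x)) (sub_pos.2 hx)
  obtain ⟨m, rfl⟩ : ∃ m, n = m + 1 := ⟨n - 1, by omega⟩
  -- The chain starts its first jump at `f x`, so the jumps alone must regain `u x - u (f x)`.
  have key : ∀ j, u (c (j + 1)) ≤ u (f x) +
      ∑ i ∈ Finset.range (j + 1), d.dist (f (c i)) (c (i + 1)) := by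
    intro j
    induction j with
    | zero =>
      have := hdist (f (c 0)) (c 1)
      rw [h0] at this
      simp only [zero_add, Finset.range_one, Finset.sum_singleton, h0]
      linarith
    | succ j ih =>
      rw [Finset.sum_range_succ]
      have h1 := hdist (f (c (j + 1))) (c (j + 1 + 1))
      have h2 := hu.2 (c (j + 1))
      linarith
  have hk := key m
  rw [hc] at hk
  have : ∑ i ∈ Finset.range (m + 1), d.dist (f (c i)) (c (i + 1)) < u x - u (f x) := hsum
  linarith

/-- A point all of whose neighborhoods contain an orbit segment returning after at least two steps
is generalized recurrent. -/
theorem mem_generalizedRecurrentSet_of_returns {X : Type*} [t : TopologicalSpace X] (f : X ≃ₜ X)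
    {y : X} (h : ∀ V ∈ 𝓝 y, ∃ z ∈ V, ∃ m : ℕ, f^[m + 2] z ∈ V) :
    y ∈ generalizedRecurrentSet f := by
  intro d hd
  subst hd
  intro ε hε
  have hV : f ⁻¹' Metric.ball (f y) (ε / 2) ∩ Metric.ball y (ε / 2) ∈ 𝓝 y :=
    inter_mem (f.continuous.continuousAt (Metric.ball_mem_nhds _ (half_pos hε)))
      (Metric.ball_mem_nhds _ (half_pos hε))
  obtain ⟨z, hz, m, hm⟩ := h _ hV
  -- The chain `y, f z, …, f^[m + 1] z, y` jumps only at its two ends; having at least two steps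
  -- keeps these jumps distinct.
  refine ⟨m + 2, fun i => if i = 0 ∨ i = m + 2 then y else f^[i] z, by omega, by simp, by simp, ?_⟩
  rw [Finset.sum_range_succ, Finset.sum_range_succ']
  have hmid : ∑ i ∈ Finset.range m,
      dist (f (if i + 1 = 0 ∨ i + 1 = m + 2 then y else f^[i + 1] z))
        (if i + 1 + 1 = 0 ∨ i + 1 + 1 = m + 2 then y else f^[i + 1 + 1] z) = 0 := by
    refine Finset.sum_eq_zero fun i hi => ?_
    have hi := Finset.mem_range.1 hi
    rw [if_neg (by omega), if_neg (by omega), ← Function.iterate_succ_apply' f, dist_self]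
  have h1 : dist (f y) (f z) < ε / 2 := by rw [dist_comm]; exact hz.1
  have h2 : dist (f^[m + 2] z) y < ε / 2 := hm.2
  beta_reduce
  rw [hmid, if_neg (show ¬(m + 1 = 0 ∨ m + 1 = m + 2) by omega), if_pos (Or.inr rfl),
    if_pos (Or.inl rfl), if_neg (show ¬(0 + 1 = 0 ∨ 0 + 1 = m + 2) by omega),
    ← Function.iterate_succ_apply' f]
  simp only [zero_add, Function.iterate_one]
  linarith

theorem mem_generalizedRecurrentSet_of_mapClusterPt {X : Type*} [TopologicalSpace X] (f : X ≃ₜ X)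
    {x y : X} (h : MapClusterPt y atTop (fun n : ℕ => f^[n] x)) :
    y ∈ generalizedRecurrentSet f := by
  refine mem_generalizedRecurrentSet_of_returns f fun V hV => ?_
  have hfr := frequently_atTop.1 (h.frequently hV)
  obtain ⟨a, -, ha⟩ := hfr 0
  obtain ⟨b, hab, hb⟩ := hfr (a + 2)
  refine ⟨f^[a] x, ha, b - (a + 2), ?_⟩
  rw [← Function.iterate_add_apply, show b - (a + 2) + 2 + a = b by omega]
  exact hb

theorem mem_generalizedRecurrentSet_of_mapClusterPt_symm {X : Type*} [TopologicalSpace X]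
    (f : X ≃ₜ X) {x y : X} (h : MapClusterPt y atTop (fun n : ℕ => f.symm^[n] x)) :
    y ∈ generalizedRecurrentSet f := by
  refine mem_generalizedRecurrentSet_of_returns f fun V hV => ?_
  have hfr := frequently_atTop.1 (h.frequently hV)
  obtain ⟨a, -, ha⟩ := hfr 0
  obtain ⟨b, hab, hb⟩ := hfr (a + 2)
  -- Forward time runs from the later backward iterate to the earlier one.
  refine ⟨f.symm^[b] x, hb, b - (a + 2), ?_⟩
  have hinv : Function.LeftInverse f^[b - (a + 2) + 2] f.symm^[b - (a + 2) + 2] :=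
    Function.LeftInverse.iterate f.apply_symm_apply _
  have hb' : f.symm^[b] x = f.symm^[b - (a + 2) + 2] (f.symm^[a] x) := by
    rw [← Function.iterate_add_apply, show b - (a + 2) + 2 + a = b by omega]
  rw [hb', hinv]
  exact ha

end Recurrence

/-! ### Convergence of orbits to a single piece. -/

section LimitSets

theorem apply_mem_iff_of_image_eq {X : Type*} [TopologicalSpace X] {f : X ≃ₜ X} {L : Set X}
    (h : f '' L = L) {x : X} : f x ∈ L ↔ x ∈ L := by
  conv_lhs => rw [← h]
  exact f.injective.mem_set_image

theorem symm_image_eq_of_image_eq {X : Type*} [TopologicalSpace X] {f : X ≃ₜ X} {L : Set X}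
    (h : f '' L = L) : f.symm '' L = L := by
  conv_lhs => rw [← h]
  rw [← image_comp, f.symm_comp_self, image_id]

theorem iterate_mem_iff_of_image_eq {X : Type*} [TopologicalSpace X] {f : X ≃ₜ X} {L : Set X}
    (h : f '' L = L) {x : X} (n : ℕ) : f^[n] x ∈ L ↔ x ∈ L := by
  induction n with
  | zero => rfl
  | succ n ih => rw [Function.iterate_succ_apply', apply_mem_iff_of_image_eq h, ih]

/-- If the limit points of an orbit lie in the union of two disjoint compact sets, the first of
which is forward invariant and contains a limit point, then the orbit converges to the first. -/
theorem eventually_iterate_mem_of_mapClusterPt {X : Type*} [TopologicalSpace X] [CompactSpace X]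
    [T2Space X] {h : X → X} (hh : Continuous h) {P Q : Set X} (hP : IsCompact P) (hQ : IsCompact Q)
    (hPQ : Disjoint P Q) (hinv : MapsTo h P P) {x : X}
    (hcl : ∀ y, MapClusterPt y atTop (fun n : ℕ => h^[n] x) → y ∈ P ∪ Q)
    {y₀ : X} (hy₀ : y₀ ∈ P) (hy₀cl : MapClusterPt y₀ atTop (fun n : ℕ => h^[n] x))
    {V : Set X} (hV : IsOpen V) (hPV : P ⊆ V) : ∀ᶠ n : ℕ in atTop, h^[n] x ∈ V := by
  obtain ⟨A, B, hA, hB, hPA, hQB, hAB⟩ := SeparatedNhds.of_isCompact_isCompact hP hQ hPQ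
  -- From `W` the next iterate is still in `A`, so an orbit eventually in `W ∪ B` cannot pass from
  -- `W` to `B`.
  let W : Set X := (A ∩ V) ∩ h ⁻¹' A
  have hW : IsOpen W := (hA.inter hV).inter (hA.preimage hh)
  have hPW : P ⊆ W := fun z hz => ⟨⟨hPA hz, hPV hz⟩, hPA (hinv hz)⟩
  have hev : ∀ᶠ n : ℕ in atTop, h^[n] x ∈ W ∪ B := by
    by_contra hne
    have hfr : ∃ᶠ n : ℕ in atTop, h^[n] x ∈ (W ∪ B)ᶜ := not_eventually.1 hne
    obtain ⟨z, hz, hzcl⟩ :=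
      (hW.union hB).isClosed_compl.isCompact.exists_mapClusterPt_of_frequently hfr
    rcases hcl z hzcl with hz' | hz'
    · exact hz (Or.inl (hPW hz'))
    · exact hz (Or.inr (hQB hz'))
  obtain ⟨N, hN⟩ := eventually_atTop.1 hev
  obtain ⟨a, haN, ha⟩ := frequently_atTop.1 (hy₀cl.frequently (hW.mem_nhds (hPW hy₀))) N
  refine eventually_atTop.2 ⟨a, fun n hn => ?_⟩
  have : h^[n] x ∈ W := by
    induction n, hn using Nat.le_induction with
    | base => exact ha
    | succ n hn ih =>
      refine (hN (n + 1) (by omega)).resolve_right fun hb => ?_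
      refine disjoint_left.1 hAB ?_ hb
      rw [Function.iterate_succ_apply']
      exact ih.2
  exact this.1.2

theorem mem_stableSet_of_mapClusterPt {X : Type*} [MetricSpace X] [CompactSpace X] (f : X ≃ₜ X)
    {P Q : Set X} (hP : IsCompact P) (hQ : IsCompact Q)
    (hPQ : Disjoint P Q) (hinv : f '' P = P) {x : X}
    (hcl : ∀ y, MapClusterPt y atTop (fun n : ℕ => f^[n] x) → y ∈ P ∪ Q)
    {y₀ : X} (hy₀ : y₀ ∈ P) (hy₀cl : MapClusterPt y₀ atTop (fun n : ℕ => f^[n] x)) :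
    x ∈ stableSet f P := by
  refine ENNReal.nhds_zero_basis.tendsto_right_iff.2 fun ε hε => ?_
  refine eventually_iterate_mem_of_mapClusterPt f.continuous hP hQ hPQ
    (fun z hz => (apply_mem_iff_of_image_eq hinv).2 hz) hcl hy₀ hy₀cl
    (V := {z | Metric.infEDist z P < ε}) (isOpen_lt Metric.continuous_infEDist continuous_const)
    fun z hz => ?_
  change Metric.infEDist z P < ε
  rw [Metric.infEDist_zero_of_mem hz]
  exact hε

/-- An orbit whose limit points lie in a finite disjoint union of compact invariant sets converges
to one of them. -/
theorem exists_mem_stableSet {X : Type*} [MetricSpace X] [CompactSpace X] (f : X ≃ₜ X) {k : ℕ}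
    {L : Fin k → Set X} (hL : ∀ i, IsCompact (L i)) (hinv : ∀ i, f '' L i = L i)
    (hdisj : ∀ i j, i ≠ j → Disjoint (L i) (L j)) {x : X}
    (hcl : ∀ y, MapClusterPt y atTop (fun n : ℕ => f^[n] x) → y ∈ ⋃ i, L i) :
    ∃ i, x ∈ stableSet f (L i) := by
  obtain ⟨y, -, hy⟩ := isCompact_univ.exists_mapClusterPt_of_frequently
    (l := atTop) (f := fun n : ℕ => f^[n] x) (Frequently.of_forall fun _ => mem_univ _)
  obtain ⟨i, hi⟩ := mem_iUnion.1 (hcl y hy)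
  refine ⟨i, mem_stableSet_of_mapClusterPt f (Q := ⋃ j : {j // j ≠ i}, L j) (hL i)
    (isCompact_iUnion fun j => hL j) (disjoint_iUnion_right.2 fun j => hdisj _ _ j.2.symm)
    (hinv i) (fun z hz => ?_) hi hy⟩
  obtain ⟨j, hj⟩ := mem_iUnion.1 (hcl z hz)
  by_cases hji : j = i
  · exact Or.inl (hji ▸ hj)
  · exact Or.inr (mem_iUnion.2 ⟨⟨j, hji⟩, hj⟩)

variable {X : Type*} [MetricSpace X] [CompactSpace X] {f : X ≃ₜ X} {k : ℕ} {L : Fin k → Set X}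

theorem IsDecomposition.exists_mem_stableSet (h : IsDecomposition f L) (x : X) :
    ∃ i, x ∈ stableSet f (L i) :=
  GenRec.exists_mem_stableSet f h.isCompact h.invariant h.pairwise_disjoint fun _ hy =>
    h.iUnion_eq ▸ mem_generalizedRecurrentSet_of_mapClusterPt f hy

theorem IsDecomposition.exists_mem_unstableSet (h : IsDecomposition f L) (x : X) :
    ∃ i, x ∈ unstableSet f (L i) :=
  GenRec.exists_mem_stableSet f.symm h.isCompact
    (fun i => symm_image_eq_of_image_eq (h.invariant i)) h.pairwise_disjoint fun _ hy =>
    h.iUnion_eq ▸ mem_generalizedRecurrentSet_of_mapClusterPt_symm f hy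

/-- A member of the decomposition without outgoing arrows contains every backward orbit that stays
in a compact set meeting no other member. -/
theorem IsDecomposition.mem_of_forall_symm_iterate_mem (h : IsDecomposition f L) {c : Fin k}
    (hc : ∀ j, ¬ Arrow f (L c) (L j)) {N : Set X} (hN : IsCompact N)
    (hNL : ∀ j, j ≠ c → Disjoint N (L j)) {x : X} (hx : ∀ n : ℕ, f.symm^[n] x ∈ N) : x ∈ L c := by
  have hcN : ∀ y ∈ N, y ∈ generalizedRecurrentSet f → y ∈ L c := by
    intro y hyN hy
    rw [h.iUnion_eq] at hy
    obtain ⟨j, hj⟩ := mem_iUnion.1 hy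
    by_contra hyc
    exact disjoint_left.1 (hNL j fun hjc => hyc (hjc ▸ hj)) hyN hj
  have hcl : ∀ y, MapClusterPt y atTop (fun n : ℕ => f.symm^[n] x) → y ∈ L c := fun y hy =>
    hcN y (hN.isClosed.mem_of_mapClusterPt hy (Eventually.of_forall hx))
      (mem_generalizedRecurrentSet_of_mapClusterPt_symm f hy)
  by_contra hxc
  have hxGR : x ∉ generalizedRecurrentSet f := fun hxG => hxc (hcN x (hx 0) hxG)
  obtain ⟨y, -, hy⟩ := isCompact_univ.exists_mapClusterPt_of_frequently
    (l := atTop) (f := fun n : ℕ => f.symm^[n] x) (Frequently.of_forall fun _ => mem_univ _)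
  have hxu : x ∈ unstableSet f (L c) :=
    mem_stableSet_of_mapClusterPt f.symm (h.isCompact c) isCompact_empty (disjoint_empty _)
      (symm_image_eq_of_image_eq (h.invariant c)) (fun z hz => Or.inl (hcl z hz)) (hcl y hy) hy
  obtain ⟨j, hj⟩ := h.exists_mem_stableSet x
  exact hc j ⟨x, ⟨hxu, hj⟩, hxGR⟩

end LimitSets

/-! ### Trapping neighborhoods and their persistence. -/

section Attractors

/-- A compact invariant set that is the maximal backward invariant subset of a neighborhood `N` has
a forward invariant compact neighborhood in `N` some iterate of which lies in its own interior. -/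
theorem exists_trapping_neighborhood {X : Type*} [TopologicalSpace X] [CompactSpace X] [T2Space X]
    (f : X ≃ₜ X) {L N : Set X} (hLinv : f '' L = L) (hN : IsClosed N)
    (hLN : L ⊆ interior N) (hmax : ∀ x, (∀ n : ℕ, f.symm^[n] x ∈ N) → x ∈ L) :
    ∃ C : Set X, IsCompact C ∧ C ⊆ N ∧ MapsTo f C C ∧ L ⊆ interior C ∧
      ∃ m : ℕ, MapsTo f^[m] C (interior C) := by
  -- The sets `K n` decrease to the maximal backward invariant subset of `N`, hence by compactness
  -- into any neighborhood of `L`. Once `f` maps `K n` into `N`, it maps `K n` into `K (n + 1)`.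
  let K : ℕ → Set X := fun n => {x | ∀ j ≤ n, f.symm^[j] x ∈ N}
  have hKeq : ∀ n, K n = ⋂ j ∈ Iic n, f.symm^[j] ⁻¹' N := fun n => by
    ext x; simp [K]
  have hKclosed : ∀ n, IsClosed (K n) := fun n => by
    rw [hKeq]
    exact isClosed_biInter fun j _ => hN.preimage (f.symm.continuous.iterate j)
  have hKanti : Antitone K := fun a b hab x hx j hj => hx j (hj.trans hab)
  have hKint : ∀ n, L ⊆ interior (K n) := fun n => by
    have hopen : IsOpen (⋂ j ∈ Iic n, f.symm^[j] ⁻¹' interior N) :=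
      (finite_Iic n).isOpen_biInter fun j _ =>
        isOpen_interior.preimage (f.symm.continuous.iterate j)
    refine subset_trans ?_ (interior_maximal ?_ hopen)
    · refine subset_iInter₂ fun j _ x hx => hLN ?_
      exact (iterate_mem_iff_of_image_eq (symm_image_eq_of_image_eq hLinv) j).2 hx
    · rw [hKeq]
      exact iInter₂_mono fun j _ => preimage_mono interior_subset
  have hsmall : ∀ W : Set X, IsOpen W → L ⊆ W → ∃ n, K n ⊆ W := fun W hW hLW =>
    exists_subset_nhds_of_isCompact' hKanti.directed_ge (fun n => (hKclosed n).isCompact) hKclosed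
      fun x hx => hW.mem_nhds (hLW (hmax x fun n => mem_iInter.1 hx n n le_rfl))
  have hstep : ∀ n x, x ∈ K n → f x ∈ N → f x ∈ K (n + 1) := by
    intro n x hx hfx j hj
    cases j with
    | zero => exact hfx
    | succ j =>
      rw [Function.iterate_succ_apply, f.symm_apply_apply]
      exact hx j (by omega)
  obtain ⟨n, hn⟩ := hsmall (f ⁻¹' interior N) (isOpen_interior.preimage f.continuous)
    fun x hx => hLN ((apply_mem_iff_of_image_eq hLinv).2 hx)
  have hfN : ∀ x ∈ K n, f x ∈ N := fun x hx => interior_subset (hn hx)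
  have hmaps : ∀ m x, x ∈ K n → f^[m] x ∈ K (n + m) := by
    intro m x hx
    induction m with
    | zero => exact hx
    | succ m ih =>
      rw [Function.iterate_succ_apply']
      exact hstep _ _ ih (hfN _ (hKanti (Nat.le_add_right n m) ih))
  obtain ⟨m, hm⟩ := hsmall (interior (K n)) isOpen_interior (hKint n)
  refine ⟨K n, (hKclosed n).isCompact, fun x hx => hx 0 (Nat.zero_le n), fun x hx =>
    hKanti (Nat.le_succ n) (hmaps 1 x hx), hKint n, m, fun x hx => ?_⟩
  exact hm (hKanti (Nat.le_add_left m n) (hmaps m x hx))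

/-- Otherwise every `x` in `C` is `f^[m * n] z` with `z` in `C`, for every `n`; forward invariance
then keeps the whole backward orbit of `x` in `C`, and maximality gives `C ⊆ L`. -/
theorem not_subset_image_iterate {X : Type*} [TopologicalSpace X] (f : X ≃ₜ X) {L N C : Set X}
    (hmax : ∀ x, (∀ n : ℕ, f.symm^[n] x ∈ N) → x ∈ L) (hCN : C ⊆ N) (hfC : MapsTo f C C)
    (hCL : ¬ C ⊆ L) {m : ℕ} (hm : 1 ≤ m) : ¬ C ⊆ f^[m] '' C := by
  intro hC
  have hback : ∀ i : ℕ, ∀ x ∈ C, ∃ z ∈ C, f^[m * i] z = x := by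
    intro i
    induction i with
    | zero => exact fun x hx => ⟨x, hx, rfl⟩
    | succ i ih =>
      intro x hx
      obtain ⟨z, hz, rfl⟩ := ih x hx
      obtain ⟨w, hw, rfl⟩ := hC hz
      exact ⟨w, hw, by rw [← Function.iterate_add_apply, Nat.mul_succ]⟩
  refine hCL fun x hx => hmax x fun n => hCN ?_
  obtain ⟨z, hz, rfl⟩ := hback n x hx
  have hle : n ≤ m * n := Nat.le_mul_of_pos_left n hm
  have hinv : Function.LeftInverse f.symm^[n] f^[n] :=
    Function.LeftInverse.iterate f.symm_apply_apply n
  obtain ⟨l, hl⟩ := Nat.exists_eq_add_of_le hle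
  rw [hl, Function.iterate_add_apply, hinv]
  exact hfC.iterate l hz

/-- If an iterate of `g` maps a closed set `C` into its interior minus a point of `C`, then `g` has
a continuous strict Lyapunov function. -/
theorem exists_isContinuousStrictLyapunov {X : Type*} [TopologicalSpace X] [CompactSpace X]
    [T2Space X] (g : X ≃ₜ X) {C : Set X} (hC : IsCompact C) {q : X} (hq : q ∈ C) {m : ℕ}
    (hm : MapsTo g^[m] C (interior C \ {q})) : ∃ u : X → ℝ, IsContinuousStrictLyapunov g u := by
  have hF : IsClosed (g^[m] '' C) := (hC.image (g.continuous.iterate m)).isClosed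
  have hG : IsClosed (interior C \ {q})ᶜ :=
    (isOpen_interior.sdiff isClosed_singleton).isClosed_compl
  obtain ⟨v, hv0, hv1, hv⟩ := exists_continuous_zero_one_of_isClosed hF hG
    (disjoint_compl_right_iff_subset.2 hm.image_subset)
  have hle : ∀ x, v (g^[m] x) ≤ v x := by
    intro x
    by_cases hx : x ∈ C
    · rw [hv0 (mem_image_of_mem _ hx)]
      exact (hv x).1
    · rw [hv1 (show x ∈ (interior C \ {q})ᶜ from fun h => hx (interior_subset h.1))]
      exact (hv _).2
  -- Summing `v` over `m` consecutive iterates turns the decrease of `v` under `g^[m]` into a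
  -- decrease under `g`.
  have hsum : ∀ x, ∑ i ∈ Finset.range m, v (g^[i] (g x)) - ∑ i ∈ Finset.range m, v (g^[i] x)
      = v (g^[m] x) - v x := by
    intro x
    rw [← Finset.sum_sub_distrib]
    exact Finset.sum_range_sub (fun i => v (g^[i] x)) m
  refine ⟨fun x => ∑ i ∈ Finset.range m, v (g^[i] x), ⟨continuous_finsetSum _ fun i _ =>
    v.continuous.comp (g.continuous.iterate i), fun x => ?_⟩, q, ?_⟩
  · have h1 := hsum x
    have h2 := hle x
    linarith
  · have h1 := hsum q
    rw [hv0 (mem_image_of_mem _ hq), hv1 (show q ∈ (interior C \ {q})ᶜ from fun h => h.2 rfl)] at h1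
    simp only [Pi.zero_apply, Pi.one_apply] at h1
    change ∑ i ∈ Finset.range m, v (g^[i] (g q)) < ∑ i ∈ Finset.range m, v (g^[i] q)
    linarith

theorem eventually_mapsTo_iterate {X : Type*} [MetricSpace X] [CompactSpace X] (f : X ≃ₜ X)
    {C U : Set X} (hC : IsCompact C) (hU : IsOpen U) {m : ℕ} (hm : MapsTo f^[m] C U) :
    ∀ᶠ g in 𝓝 f, MapsTo (g : X ≃ₜ X)^[m] C U := by
  let toC : (X ≃ₜ X) → C(X, X) := fun g => ⟨g, g.continuous⟩
  have hcont : Continuous toC := continuous_induced_dom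
  have hiter : ∀ j : ℕ, Continuous fun g : X ≃ₜ X =>
      (⟨g^[j], g.continuous.iterate j⟩ : C(X, X)) := by
    intro j
    induction j with
    | zero => exact continuous_const (y := ContinuousMap.id X)
    | succ j ih => exact ih.compCM hcont
  exact (hiter m).continuousAt.eventually
    ((ContinuousMap.isOpen_setOfPred_mapsTo hC hU).mem_nhds hm)

end Attractors

/-! ### Cycles in finite directed graphs. -/

section Cycles

/-- A relation on a finite type in which every vertex with an incoming arrow has an outgoing arrow,
and which has an arrow, contains a cycle of distinct vertices. -/
theorem exists_cycle_of_forall_exists {α : Type*} [Finite α] {R : α → α → Prop}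
    (hR : ∀ a b, R a b → ∃ c, R b c) {a b : α} (hab : R a b) :
    ∃ (r : ℕ) (σ : Fin r → α), 1 ≤ r ∧ Function.Injective σ ∧
      ∀ j, R (σ j) (σ (finRotate r j)) := by
  -- A choice of successors is a self-map of the finite set of heads of arrows; a periodic orbit
  -- over its minimal period is a cycle of distinct vertices.
  let S := {b : α // ∃ a, R a b}
  have hS : ∀ s : S, ∃ t : S, R s t := by
    rintro ⟨b, a, hb⟩
    obtain ⟨c, hc⟩ := hR a b hb
    exact ⟨⟨c, b, hc⟩, hc⟩
  choose s hs using hS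
  have hper : ∃ y : S, y ∈ Function.periodicPts s := by
    obtain ⟨m, n, hmn, heq⟩ :=
      Finite.exists_ne_map_eq_of_infinite fun i : ℕ => s^[i] (⟨b, a, hab⟩ : S)
    wlog hlt : m < n generalizing m n
    · exact this n m hmn.symm heq.symm (by omega)
    refine ⟨s^[m] ⟨b, a, hab⟩, n - m, by omega, ?_⟩
    change s^[n - m] (s^[m] _) = _
    rw [← Function.iterate_add_apply, show n - m + m = n by omega]
    exact heq.symm
  obtain ⟨y, hy⟩ := hper
  obtain ⟨r, hr⟩ : ∃ r, Function.minimalPeriod s y = r + 1 :=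
    ⟨Function.minimalPeriod s y - 1, by
      have := Function.minimalPeriod_pos_of_mem_periodicPts hy; omega⟩
  refine ⟨r + 1, fun j => (s^[(j : ℕ)] y : S), by omega, fun i j hij => ?_, fun j => ?_⟩
  · have hlt : ∀ l : Fin (r + 1), (l : ℕ) ∈ Iio (Function.minimalPeriod s y) := fun l => by
      rw [hr]; exact l.2
    exact Fin.ext (Function.iterate_injOn_Iio_minimalPeriod (hlt i) (hlt j) (Subtype.ext hij))
  · have hrot : s^[(finRotate (r + 1) j : ℕ)] y = s (s^[(j : ℕ)] y) := by
      rw [← Function.iterate_succ_apply' s]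
      rcases eq_or_ne j (Fin.last r) with rfl | hj
      · rw [finRotate_last, Fin.val_last, Nat.succ_eq_add_one]
        exact (hr ▸ Function.iterate_minimalPeriod : s^[r + 1] y = y).symm
      · rw [coe_finRotate_of_ne_last hj]
    change R _ (s^[(finRotate (r + 1) j : ℕ)] y : S)
    rw [hrot]
    exact hs _

theorem HasNoCycles.exists_sink {X : Type*} [MetricSpace X] {f : X ≃ₜ X} {k : ℕ}
    {L : Fin k → Set X} (h : HasNoCycles f L) {a b : Fin k} (hab : Arrow f (L a) (L b)) :
    ∃ a' c, Arrow f (L a') (L c) ∧ ∀ j, ¬ Arrow f (L c) (L j) := by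
  by_contra! hne
  obtain ⟨r, σ, hr, hσ, hc⟩ :=
    exists_cycle_of_forall_exists (R := fun i j => Arrow f (L i) (L j)) hne hab
  exact h r σ hσ ⟨hr, hc⟩

end Cycles

/-- On a compact metric space, having a continuous strict Lyapunov function is stable near a
homeomorphism whose generalized recurrent set has a decomposition without cycles. -/
theorem eventually_exists_isContinuousStrictLyapunov {X : Type*} [MetricSpace X] [CompactSpace X]
    (f : X ≃ₜ X) (hf : ∃ u : X → ℝ, IsContinuousStrictLyapunov f u) {k : ℕ} {L : Fin k → Set X}
    (hL : IsDecomposition f L) (hcyc : HasNoCycles f L) :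
    ∀ᶠ g in 𝓝 f, ∃ u : X → ℝ, IsContinuousStrictLyapunov g u := by
  obtain ⟨u, hu, x₀, hx₀⟩ := hf
  obtain ⟨a, ha⟩ := hL.exists_mem_unstableSet x₀
  obtain ⟨b, hb⟩ := hL.exists_mem_stableSet x₀
  obtain ⟨-, c, ⟨y, ⟨-, hyc⟩, hy⟩, hsink⟩ := hcyc.exists_sink
    (a := a) (b := b) ⟨x₀, ⟨ha, hb⟩, notMem_generalizedRecurrentSet f hu hx₀⟩
  have hyL : y ∉ L c := fun h => hy (hL.iUnion_eq ▸ mem_iUnion.2 ⟨c, h⟩)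
  let Q : Set X := ⋃ j : {j // j ≠ c}, L j
  have hQ : IsCompact Q := isCompact_iUnion fun j => hL.isCompact j
  have hcQ : Disjoint (L c) Q :=
    disjoint_iUnion_right.2 fun j => hL.pairwise_disjoint _ _ j.2.symm
  obtain ⟨A, B, hA, hB, hcA, hQB, hAB⟩ :=
    SeparatedNhds.of_isCompact_isCompact (hL.isCompact c) hQ hcQ
  have hmax : ∀ x, (∀ n : ℕ, f.symm^[n] x ∈ Bᶜ) → x ∈ L c := fun x hx =>
    hL.mem_of_forall_symm_iterate_mem hsink hB.isClosed_compl.isCompact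
      (fun j hj => disjoint_left.2 fun z hz hzj => hz (hQB (mem_iUnion.2 ⟨⟨j, hj⟩, hzj⟩))) hx
  obtain ⟨C, hC, hCN, hfC, hLC, m, hm⟩ := exists_trapping_neighborhood f (hL.invariant c)
    hB.isClosed_compl (hcA.trans (interior_maximal hAB.subset_compl_right hA)) hmax
  -- The orbit of `y` enters `C` but never `L c`, which is invariant and misses `y`.
  have hCL : ¬ C ⊆ L c := by
    obtain ⟨ε, hε, hεC⟩ := (hL.isCompact c).exists_thickening_subset_open isOpen_interior hLC
    obtain ⟨i, hi⟩ :=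
      (hyc.eventually_lt_const (ENNReal.ofReal_pos.2 hε) : ∀ᶠ i in atTop, _).exists
    intro hsub
    exact hyL ((iterate_mem_iff_of_image_eq (hL.invariant c) i).1
      (hsub (interior_subset (hεC (Metric.mem_thickening_iff_infEDist_lt.2 hi)))))
  -- The exponent `m` may be `0`; one more iterate makes it positive, as needed to find `q`.
  have hm' : MapsTo f^[m + 1] C (interior C) := fun x hx => by
    rw [Function.iterate_succ_apply]
    exact hm (hfC hx)
  obtain ⟨q, hqC, hq⟩ := not_subset_iff_exists_mem_notMem.1
    (not_subset_image_iterate f hmax hCN hfC hCL (Nat.le_add_left 1 m))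
  have hm'' : MapsTo f^[m + 1] C (interior C \ {q}) := fun x hx =>
    ⟨hm' hx, fun h => hq ⟨x, hx, h⟩⟩
  filter_upwards [eventually_mapsTo_iterate f hC (isOpen_interior.sdiff isClosed_singleton) hm'']
    with g hg
  exact exists_isContinuousStrictLyapunov g hC hqC hg

end GenRec

theorem mainTheorem9 (n : ℕ) (hn : 2 ≤ n) (M : Type*) [MetricSpace M] [CompactSpace M]
    [ChartedSpace (EuclideanSpace ℝ (Fin n)) M] (f : M ≃ₜ M)
    (hf : ∃ u : M → ℝ, GenRec.IsContinuousStrictLyapunov f u)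
    (hdec : ∃ (k : ℕ) (L : Fin k → Set M),
      GenRec.IsDecomposition f L ∧ GenRec.HasNoCycles f L) :
    ∃ V ∈ 𝓝 f, ∀ g ∈ V, ∃ u : M → ℝ, GenRec.IsContinuousStrictLyapunov g u := by
  obtain ⟨k, L, hL, hcyc⟩ := hdec
  exact ⟨_, GenRec.eventually_exists_isContinuousStrictLyapunov f hf hL hcyc, fun _ hg => hg⟩
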